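/- Let $d\ge 0$ be an integer and identify $a=(a_0,\dots,a_{d-1})\in\mathbb{R}^d$ with the monic polynomial $Q_a=x^d+\sum_{j=0}^{d-1}a_jx^j$. Let $E_d\subset\mathbb{R}^d$ be the set of all $a$ such that $Q_a$ has a positive root and a negative root of equal moduli, $F_d$ the set of all $a$ such that $Q_a$ has a conjugate pair of nonzero purely imaginary roots, and $G_d$ the set of all $a$ such that $0$ is a root of $Q_a$ of multiplicity at least $2$. Put $\tilde E_d=E_d\cup F_d\cup G_d$. By an equality between a positive root and the modulus of a negative root we mean a number $v>0$ such that $v$ and $-v$ are both roots. A smooth hypersurface in an open set $U$ is the zero set in $U$ of a $C^\infty$ function $U\to\mathbb{R}$ whose differential vanishes nowhere on $U$. We say that a set $S\subset\mathbb{R}^d$ is, near a point $p$, a transversal crossing of $s$ smooth hypersurfaces if for some open neighbourhood $U$ of $p$ there are $s$ smooth hypersurfaces in $U$ which all pass through $p$, whose union is $S\cap U$, and whose $s$ normal vectors at $p$ (the differentials of their equations) are linearly independent. Then for every $p\in\mathbb{R}^d$: (1) If $Q_p$ has $d$ distinct real roots and there is exactly one equality between a positive root and the modulus of a negative root, then near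 $p$ the set $E_d$ is a smooth hypersurface (through $p$). (2) If $Q_p$ has $d$ distinct real roots and there are exactly $s$ equalities between positive roots and moduli of negative roots, then near $p$ the set $E_d$ is a transversal crossing of $s$ smooth hypersurfaces. (3) If $Q_p$ has $d$ distinct complex roots (it need not have only real roots), exactly $s_1$ equalities between positive roots and moduli of negative roots, and exactly $s_2$ conjugate pairs of nonzero purely imaginary roots, then near $p$ the set $\tilde E_d$ is a transversal crossing of $s_1+s_2$ smooth hypersurfaces. (4) Suppose that either $Q_p$ has two opposite real roots $\pm v$, $v>0$, both of multiplicity exactly $2$, no other pair of opposite nonzero real roots and no nonzero purely imaginary roots, or $Q_p$ has a pair of purely imaginary roots $\pm iv$, $v>0$, both of multiplicity exactly $2$, no other nonzero purely imaginary roots and no pair of opposite nonzero real roots; in both cases suppose that $0$ is not a multiple root of $Q_p$. (This is so in particular if the moduli of all other roots are distinct and different from $v$.) Then $d\geq 4$ and $\tilde E_d$ is, near $p$, diffeomorphic to the product of $\mathbb{R}^{d-3}$ with the Whitney umbrella $\{(u,uv,v^2): u,v\in\mathbb{R}\}\subset\mathbb{R}^3$ near $(0,0)$: there is a $C^\infty$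 diffeomorphism $\varphi$ from an open neighbourhood $U$ of $p$ onto an open neighbourhood $U'$ of the origin in $\mathbb{R}^{d-3}\times\mathbb{R}^3$ with $\varphi(p)=(0,0)$ that maps $\tilde E_d\cap U$ onto the intersection of $U'$ with $\mathbb{R}^{d-3}\times\{(u,uv,v^2): u,v\in\mathbb{R}\}$. -/

import Mathlib

open scoped ContDiff Polynomial

noncomputable section

namespace RootModuli

/-- The monic polynomial `x ^ d + ∑_{j < d} a_j x ^ j` with coefficient vector `a ∈ ℝ ^ d`. -/
def Q {d : ℕ} (a : Fin d → ℝ) : ℝ[X] :=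
  Polynomial.X ^ d + ∑ j : Fin d, Polynomial.C (a j) * Polynomial.X ^ (j : ℕ)

/-- The set of real roots of `Q a`. -/
def realRoots {d : ℕ} (a : Fin d → ℝ) : Set ℝ :=
  {x | (Q a).IsRoot x}

/-- The set of complex roots of `Q a`. -/
def complexRoots {d : ℕ} (a : Fin d → ℝ) : Set ℂ :=
  {z | Polynomial.aeval z (Q a) = 0}

/-- The equalities between a positive root and the modulus of a negative root, each recorded
by the common modulus `v`: the roots in question are `v` and `-v`. -/
def oppositeModuli {d : ℕ} (a : Fin d → ℝ) : Set ℝ :=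
  {v | 0 < v ∧ v ∈ realRoots a ∧ -v ∈ realRoots a}

/-- The conjugate pairs `± i w` of (nonzero) purely imaginary roots, each recorded by `w > 0`. -/
def imaginaryModuli {d : ℕ} (a : Fin d → ℝ) : Set ℝ :=
  {w | 0 < w ∧ (w : ℂ) * Complex.I ∈ complexRoots a ∧ -((w : ℂ) * Complex.I) ∈ complexRoots a}

/-- The multiplicity of the complex number `z` as a root of `Q a` (zero if `z` is no root). -/
def multiplicityAt {d : ℕ} (a : Fin d → ℝ) (z : ℂ) : ℕ :=
  ((Q a).map (algebraMap ℝ ℂ)).rootMultiplicity z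

/-- A positive root and a negative root have equal moduli. -/
def E (d : ℕ) : Set (Fin d → ℝ) :=
  {a | ∃ x ∈ realRoots a, ∃ y ∈ realRoots a, 0 < x ∧ y < 0 ∧ |x| = |y|}

/-- There is a conjugate pair of purely imaginary roots. -/
def F (d : ℕ) : Set (Fin d → ℝ) :=
  {a | (imaginaryModuli a).Nonempty}

/-- There is a double root at `0`. -/
def G (d : ℕ) : Set (Fin d → ℝ) :=
  {a | 2 ≤ multiplicityAt a 0}

/-- The union of the three sets above. -/
def Etilde (d : ℕ) : Set (Fin d → ℝ) :=
  E d ∪ F d ∪ G d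

section LocalGeometry

variable {V : Type*} [NormedAddCommGroup V] [NormedSpace ℝ V]
variable {W : Type*} [NormedAddCommGroup W] [NormedSpace ℝ W]

/-- In the open set `U`, `H` is the smooth hypersurface with the regular equation `f = 0`. -/
def IsHypersurfaceWithEquation (U H : Set V) (f : V → ℝ) : Prop :=
  ContDiffOn ℝ ∞ f U ∧ (∀ x ∈ U, fderiv ℝ f x ≠ 0) ∧ H = {x ∈ U | f x = 0}

/-- `p ∈ S`, and near `p` the set `S` is a smooth hypersurface. -/
def IsLocallySmoothHypersurface (S : Set V) (p : V) : Prop :=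
  ∃ U : Set V, IsOpen U ∧ p ∈ U ∧ p ∈ S ∧
    ∃ f : V → ℝ, IsHypersurfaceWithEquation U (S ∩ U) f

/-- Near `p` the set `S` consists of `s` smooth hypersurfaces (it is their union) which all pass
through `p` and intersect transversally there: the differentials at `p` of their equations, that
is, their normal vectors, are linearly independent. -/
def IsLocallyTransversalCrossing (S : Set V) (p : V) (s : ℕ) : Prop :=
  ∃ U : Set V, IsOpen U ∧ p ∈ U ∧
    ∃ (H : Fin s → Set V) (f : Fin s → V → ℝ),
      (∀ i, IsHypersurfaceWithEquation U (H i) (f i)) ∧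
      (∀ i, p ∈ H i) ∧
      LinearIndependent ℝ (fun i => fderiv ℝ (f i) p) ∧
      S ∩ U = ⋃ i, H i

/-- A smooth diffeomorphism from a neighbourhood of `p` onto a neighbourhood of `q` sends `p` to
`q` and `S` (near `p`) onto `T` (near `q`). -/
def IsLocallyDiffeomorphic (S : Set V) (p : V) (T : Set W) (q : W) : Prop :=
  ∃ φ : OpenPartialHomeomorph V W, p ∈ φ.source ∧ φ p = q ∧
    ContDiffOn ℝ ∞ φ φ.source ∧ ContDiffOn ℝ ∞ φ.symm φ.target ∧
    φ '' (S ∩ φ.source) = T ∩ φ.target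

end LocalGeometry

/-- The Whitney umbrella (cross-cap) in `ℝ ^ 3`, the image of `(u, v) ↦ (u, u v, v ^ 2)`;
its pinch point is the origin. -/
def whitneyUmbrella : Set (Fin 3 → ℝ) :=
  {q | ∃ u v : ℝ, q = ![u, u * v, v ^ 2]}

end RootModuli

end

/-!
Write `Q_a(x) = A_a(x²) + x B_a(x²)`. For `z ≠ 0` the numbers `z` and `-z` are both roots of `Q_a` if
and only if `t = z²` is a common root of `A_a` and `B_a`, and `0` is a multiple root of `Q_a` if and
only if `t = 0` is such a common root. Hence `Etilde d` is the set of all `a` for which `A_a` and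
`B_a` have a common real root `t` (`mem_Etilde_iff`), and `E d` is the part with `t > 0`. The
common real roots `t` are those with `X² - t ∣ Q_a`; they form the set `squares a`. By Cauchy's bound
and compactness they stay close to `squares p` when `a` is close to `p`
(`eventually_squares_subset`), so each of them can be studied on its own.

*Simple roots.* If `(X² - t)² ∤ Q_p`, then `A_p'(t)` and `B_p'(t)` do not both vanish, and the
implicit function theorem gives a smooth equation for the set of those `a` which have a common root
near `t`: insert the root of one part into the other part. Its differential is a multiple of
`h ↦ B_p'(t) A_h(t) - A_p'(t) B_h(t)`. For distinct `t_i` these covectors are independent, as one sees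
by testing them on the directions `(α + β x) ∏_{j ≠ i} (x² - t_j)`, whose degree is less than `d`
(`isLocallyTransversalCrossing_of_simple`).

*Double roots.* If `X² - t₀` divides `Q_p` exactly twice, then `t₀` is a multiple root of both parts
and exactly double for one of them, say `B_p`. Dividing by `(x - m)² - n` gives remainders
`b₁ + (x - m) b₂` of `B_a` and `k₁ + (x - m) k₂` of `A_a`, which are analytic in `(a, m, n)`. The
equations `b₁ = b₂ = 0` can be solved for `(m, n)` near `(t₀, 0)`. Then `t` near `t₀` is a
root of `B_a` if and only if `(t - m)² = n`, and a root of `A_a` as well if and only if moreover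
`k₁ + (t - m) k₂ = 0`. With `u = -k₂` and `v = t - m` this says that
`(-k₂, k₁, n) = (u, u v, v²)`, so `Etilde d` is the preimage of the Whitney umbrella under
`a ↦ (-k₂, k₁, n)`. This map is a submersion at `p` because `d ≥ 4` makes the 1-jets of `A_h` and `B_h`
at `t₀` arbitrary (`exists_submersion`, `isLocallyDiffeomorphic_whitneyUmbrella`).

Smoothness is obtained in the form `ContDiffAt ℝ ω`: unlike `ContDiffAt ℝ ∞`, analyticity
at a point spreads to a neighbourhood.
-/

noncomputable section

namespace RootModuli

open Polynomial Filter Topology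

/-! ### Even and odd parts, and pairs of opposite roots -/

/-- The linear map sending `P` to the polynomial `A` in `P(x) = A(x²) + x B(x²)`. -/
def evenPart : ℝ[X] →ₗ[ℝ] ℝ[X] where
  toFun P := contract 2 P
  map_add' P R := contract_add two_ne_zero P R
  map_smul' c P := by ext n; simp [coeff_contract]

/-- The linear map sending `P` to the polynomial `B` in `P(x) = A(x²) + x B(x²)`. -/
def oddPart : ℝ[X] →ₗ[ℝ] ℝ[X] where
  toFun P := contract 2 P.divX
  map_add' P R := by ext n; simp [coeff_contract, coeff_divX]
  map_smul' c P := by ext n; simp [coeff_contract, coeff_divX]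

@[simp] lemma coeff_evenPart (P : ℝ[X]) (n : ℕ) : (evenPart P).coeff n = P.coeff (n * 2) :=
  coeff_contract two_ne_zero P n

@[simp] lemma coeff_oddPart (P : ℝ[X]) (n : ℕ) : (oddPart P).coeff n = P.coeff (n * 2 + 1) := by
  change (contract 2 P.divX).coeff n = _
  rw [coeff_contract two_ne_zero, coeff_divX]

lemma expand_evenPart_add_X_mul_expand_oddPart (P : ℝ[X]) :
    expand ℝ 2 (evenPart P) + X * expand ℝ 2 (oddPart P) = P := by
  ext n
  rcases n with _ | n
  · simp [coeff_expand]
  · rw [coeff_add, coeff_X_mul, coeff_expand two_pos, coeff_expand two_pos]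
    rcases Nat.even_or_odd' n with ⟨k, rfl | rfl⟩
    · rw [if_neg (by omega), if_pos (by omega), coeff_oddPart]
      simp only [zero_add]; congr 1; omega
    · rw [if_pos (by omega), if_neg (by omega), coeff_evenPart]
      simp only [add_zero]; congr 1; omega

lemma evenPart_expand_add (u w : ℝ[X]) :
    evenPart (expand ℝ 2 u + X * expand ℝ 2 w) = u := by
  ext n
  rcases n with _ | n
  · simp [coeff_expand]
  · rw [coeff_evenPart, coeff_add, show (n + 1) * 2 = (2 * n + 1) + 1 by ring, coeff_X_mul,
      coeff_expand two_pos, coeff_expand two_pos, if_pos (by omega), if_neg (by omega), add_zero]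
    congr 1; omega

lemma oddPart_expand_add (u w : ℝ[X]) :
    oddPart (expand ℝ 2 u + X * expand ℝ 2 w) = w := by
  ext n
  rw [coeff_oddPart, coeff_add, coeff_X_mul, coeff_expand two_pos, coeff_expand two_pos,
    if_neg (by omega), if_pos (by omega), zero_add]
  congr 1; omega

lemma expand_X_sub_C_pow (t : ℝ) (k : ℕ) : expand ℝ 2 ((X - C t) ^ k) = (X ^ 2 - C t) ^ k := by
  simp

lemma X_sq_sub_C_pow_dvd_iff (P : ℝ[X]) (t : ℝ) (k : ℕ) :
    (X ^ 2 - C t) ^ k ∣ P ↔ (X - C t) ^ k ∣ evenPart P ∧ (X - C t) ^ k ∣ oddPart P := by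
  rw [← expand_X_sub_C_pow]
  constructor
  · rintro ⟨g, rfl⟩
    have h : expand ℝ 2 ((X - C t) ^ k) * g
        = expand ℝ 2 ((X - C t) ^ k * evenPart g) + X * expand ℝ 2 ((X - C t) ^ k * oddPart g) := by
      conv_lhs => rw [← expand_evenPart_add_X_mul_expand_oddPart g]
      rw [map_mul, map_mul]; ring
    rw [h, evenPart_expand_add, oddPart_expand_add]
    exact ⟨dvd_mul_right _ _, dvd_mul_right _ _⟩
  · rintro ⟨⟨u, hu⟩, ⟨w, hw⟩⟩
    rw [← expand_evenPart_add_X_mul_expand_oddPart P, hu, hw, map_mul, map_mul]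
    exact ⟨expand ℝ 2 u + X * expand ℝ 2 w, by ring⟩

section Polynomials

variable {d : ℕ}

/-- The polynomial `∑_{j < d} h_j x ^ j`, that is, the derivative of `a ↦ Q a` in the direction `h`. -/
def lowerPart (h : Fin d → ℝ) : ℝ[X] := ∑ j : Fin d, h j • (X : ℝ[X]) ^ (j : ℕ)

lemma Q_eq (a : Fin d → ℝ) : Q a = X ^ d + lowerPart a := by
  simp [Q, lowerPart, smul_eq_C_mul]

lemma degree_lowerPart_lt (h : Fin d → ℝ) : (lowerPart h).degree < d := by
  refine (degree_sum_le _ _).trans_lt ((Finset.sup_lt_iff (WithBot.bot_lt_coe d)).2 fun j _ => ?_)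
  exact ((degree_smul_le _ _).trans (degree_X_pow_le _)).trans_lt
    (Nat.cast_lt.2 j.2)

lemma lowerPart_coeff (h : Fin d → ℝ) (j : Fin d) : (lowerPart h).coeff j = h j := by
  simp only [lowerPart, coeff_X_pow, finsetSum_coeff, coeff_smul, smul_eq_mul]
  rw [Finset.sum_eq_single j]
  · simp
  · intro i _ hi
    rw [if_neg (fun h => hi (Fin.ext h.symm)), mul_zero]
  · simp

lemma exists_lowerPart_eq (g : ℝ[X]) (hg : g.degree < d) : ∃ h : Fin d → ℝ, lowerPart h = g := by
  refine ⟨fun j => g.coeff j, ?_⟩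
  ext n
  by_cases hn : n < d
  · exact lowerPart_coeff _ ⟨n, hn⟩
  · have hn' : (d : WithBot ℕ) ≤ n := Nat.cast_le.2 (not_lt.1 hn)
    rw [coeff_eq_zero_of_degree_lt ((degree_lowerPart_lt _).trans_le hn'),
      coeff_eq_zero_of_degree_lt (hg.trans_le hn')]

lemma Q_monic (a : Fin d → ℝ) : (Q a).Monic := by
  rw [Q_eq]; exact monic_X_pow_add (degree_lowerPart_lt a)

lemma natDegree_Q (a : Fin d → ℝ) : (Q a).natDegree = d := by
  rw [Q_eq]
  refine natDegree_eq_of_degree_eq_some ?_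
  rw [degree_add_eq_left_of_degree_lt (by rw [degree_X_pow]; exact degree_lowerPart_lt a),
    degree_X_pow]

lemma Q_coeff (a : Fin d → ℝ) (j : Fin d) : (Q a).coeff j = a j := by
  rw [Q_eq, coeff_add, coeff_X_pow, if_neg j.2.ne, zero_add, lowerPart_coeff]

/-- The real numbers `t` such that both square roots of `t` are roots of `Q a`
(`0` counting as a double root). They are the common roots of the even and the odd part of `Q a`. -/
def squares (a : Fin d → ℝ) : Set ℝ := {t | X ^ 2 - C t ∣ Q a}

lemma mem_squares_iff_dvd (a : Fin d → ℝ) (t : ℝ) :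
    t ∈ squares a ↔ (X ^ 2 - C t) ^ 1 ∣ Q a := by rw [pow_one]; rfl

lemma mem_squares_iff (a : Fin d → ℝ) (t : ℝ) :
    t ∈ squares a ↔ (evenPart (Q a)).eval t = 0 ∧ (oddPart (Q a)).eval t = 0 := by
  rw [mem_squares_iff_dvd, X_sq_sub_C_pow_dvd_iff, pow_one, dvd_iff_isRoot, dvd_iff_isRoot]
  rfl

lemma le_multiplicityAt_iff (a : Fin d → ℝ) (z : ℂ) (k : ℕ) :
    k ≤ multiplicityAt a z ↔ (X - C z) ^ k ∣ (Q a).map (algebraMap ℝ ℂ) :=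
  le_rootMultiplicity_iff ((Q_monic a).map _).ne_zero

lemma X_sq_sub_C_pow_dvd_Q_iff (a : Fin d → ℝ) {t : ℝ} {z : ℂ} (hz : z ≠ 0) (h : z ^ 2 = t)
    (k : ℕ) :
    (X ^ 2 - C t) ^ k ∣ Q a ↔ k ≤ multiplicityAt a z ∧ k ≤ multiplicityAt a (-z) := by
  rw [le_multiplicityAt_iff, le_multiplicityAt_iff, ← map_dvd_map' (algebraMap ℝ ℂ)]
  have e : ((X ^ 2 - C t) ^ k).map (algebraMap ℝ ℂ) = (X - C z) ^ k * (X - C (-z)) ^ k := by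
    rw [← mul_pow]
    simp only [Polynomial.map_pow, Polynomial.map_sub, map_X, map_C, Complex.coe_algebraMap, ← h]
    congr 1; simp; ring
  have hc : IsCoprime ((X - C z) ^ k) ((X - C (-z)) ^ k) := by
    refine IsCoprime.pow (isCoprime_X_sub_C_of_isUnit_sub ?_)
    rw [sub_neg_eq_add, ← two_mul]
    exact (mul_ne_zero two_ne_zero hz).isUnit
  rw [e]
  exact ⟨fun h => ⟨(dvd_mul_right _ _).trans h, (dvd_mul_left _ _).trans h⟩,
    fun h => hc.mul_dvd h.1 h.2⟩

lemma zero_mem_squares_iff (a : Fin d → ℝ) : (0 : ℝ) ∈ squares a ↔ 2 ≤ multiplicityAt a 0 := by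
  rw [le_multiplicityAt_iff, squares, Set.mem_ofPred_eq, ← map_dvd_map' (algebraMap ℝ ℂ)]
  simp

lemma one_le_multiplicityAt_iff (a : Fin d → ℝ) (z : ℂ) :
    1 ≤ multiplicityAt a z ↔ z ∈ complexRoots a := by
  rw [le_multiplicityAt_iff, pow_one, dvd_iff_isRoot, IsRoot.def, eval_map_algebraMap]
  rfl

lemma ofReal_mem_complexRoots_iff (a : Fin d → ℝ) (x : ℝ) :
    (x : ℂ) ∈ complexRoots a ↔ x ∈ realRoots a := by
  have := aeval_algebraMap_apply ℂ x (Q a)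
  rw [complexRoots, Set.mem_ofPred_eq, ← Complex.coe_algebraMap, this]
  simp [realRoots]

lemma mem_oppositeModuli_iff (a : Fin d → ℝ) (v : ℝ) :
    v ∈ oppositeModuli a ↔ 0 < v ∧ v ^ 2 ∈ squares a := by
  refine and_congr_right fun hv => ?_
  rw [mem_squares_iff_dvd, X_sq_sub_C_pow_dvd_Q_iff a (z := v) (by exact_mod_cast hv.ne')
    (by simp), one_le_multiplicityAt_iff, one_le_multiplicityAt_iff, ← Complex.ofReal_neg,
    ofReal_mem_complexRoots_iff, ofReal_mem_complexRoots_iff]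

lemma mem_imaginaryModuli_iff (a : Fin d → ℝ) (w : ℝ) :
    w ∈ imaginaryModuli a ↔ 0 < w ∧ -w ^ 2 ∈ squares a := by
  refine and_congr_right fun hw => ?_
  rw [mem_squares_iff_dvd, X_sq_sub_C_pow_dvd_Q_iff a (z := w * Complex.I)
    (by simp [hw.ne']) (by simp [mul_pow]), one_le_multiplicityAt_iff, one_le_multiplicityAt_iff]

lemma mem_E_iff (a : Fin d → ℝ) : a ∈ E d ↔ ∃ t ∈ squares a, 0 < t := by
  constructor
  · rintro ⟨x, hx, y, hy, hx0, hy0, h⟩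
    rw [abs_of_pos hx0, abs_of_neg hy0] at h
    refine ⟨x ^ 2, ((mem_oppositeModuli_iff a x).1 ⟨hx0, hx, ?_⟩).2, by positivity⟩
    rw [h, neg_neg]; exact hy
  · rintro ⟨t, ht, h0⟩
    obtain ⟨h1, h2, h3⟩ := (mem_oppositeModuli_iff a √t).2
      ⟨Real.sqrt_pos.2 h0, by rwa [Real.sq_sqrt h0.le]⟩
    exact ⟨_, h2, _, h3, h1, by linarith, by simp⟩

lemma mem_F_iff (a : Fin d → ℝ) : a ∈ F d ↔ ∃ t ∈ squares a, t < 0 := by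
  constructor
  · rintro ⟨w, hw⟩
    obtain ⟨h1, h2⟩ := (mem_imaginaryModuli_iff a w).1 hw
    exact ⟨_, h2, by nlinarith⟩
  · rintro ⟨t, ht, h0⟩
    refine ⟨√(-t), (mem_imaginaryModuli_iff a _).2 ⟨Real.sqrt_pos.2 (by linarith), ?_⟩⟩
    rwa [Real.sq_sqrt (by linarith), neg_neg]

lemma mem_Etilde_iff (a : Fin d → ℝ) : a ∈ Etilde d ↔ (squares a).Nonempty := by
  rw [Etilde, Set.mem_union, Set.mem_union, mem_E_iff, mem_F_iff,
    show a ∈ G d ↔ (0 : ℝ) ∈ squares a from (zero_mem_squares_iff a).symm]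
  constructor
  · rintro ((⟨t, ht, -⟩ | ⟨t, ht, -⟩) | ht) <;> exact ⟨_, ht⟩
  · rintro ⟨t, ht⟩
    rcases lt_trichotomy t 0 with h | rfl | h
    · exact Or.inl (Or.inr ⟨t, ht, h⟩)
    · exact Or.inr ht
    · exact Or.inl (Or.inl ⟨t, ht, h⟩)

lemma squares_eq (a : Fin d → ℝ) (h0 : multiplicityAt a 0 ≤ 1) :
    squares a = (fun v => v ^ 2) '' oppositeModuli a ∪ (fun w => -w ^ 2) '' imaginaryModuli a := by
  ext t
  simp only [Set.mem_union, Set.mem_image, mem_oppositeModuli_iff, mem_imaginaryModuli_iff]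
  constructor
  · intro ht
    rcases lt_trichotomy t 0 with h | rfl | h
    · have e : √(-t) ^ 2 = -t := Real.sq_sqrt (by linarith)
      exact Or.inr ⟨√(-t), ⟨Real.sqrt_pos.2 (by linarith), by rwa [e, neg_neg]⟩, by rw [e, neg_neg]⟩
    · have := (zero_mem_squares_iff a).1 ht
      omega
    · have e : √t ^ 2 = t := Real.sq_sqrt h.le
      exact Or.inl ⟨√t, ⟨Real.sqrt_pos.2 h, by rwa [e]⟩, e⟩
  · rintro (⟨v, hv, rfl⟩ | ⟨w, hw, rfl⟩)
    · exact hv.2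
    · exact hw.2

lemma prod_dvd_Q (a : Fin d → ℝ) (s : Finset ℝ) (hs : ∀ t ∈ s, t ∈ squares a) :
    ∏ t ∈ s, (X ^ 2 - C t) ∣ Q a := by
  refine Finset.prod_dvd_of_coprime (fun t _ u _ htu => ?_) hs
  have h := (isCoprime_expand (R := ℝ) (p := 2) two_ne_zero).2 (isCoprime_X_sub_C_of_isUnit_sub
    (sub_ne_zero.2 htu).isUnit)
  simpa using h

lemma two_mul_card_le (a : Fin d → ℝ) (s : Finset ℝ) (hs : ∀ t ∈ s, t ∈ squares a) :
    2 * s.card ≤ d := by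
  have h := natDegree_le_of_dvd (prod_dvd_Q a s hs) (Q_monic a).ne_zero
  rw [natDegree_Q, natDegree_prod _ _ fun t _ => (monic_X_pow_sub_C t two_ne_zero).ne_zero] at h
  simpa [natDegree_X_pow_sub_C, mul_comm] using h

lemma squares_finite (a : Fin d → ℝ) : (squares a).Finite := by
  by_contra h
  obtain ⟨s, hs, hc⟩ := Set.Infinite.exists_subset_card_eq h (d + 1)
  have := two_mul_card_le a s hs
  omega

lemma ncard_squares (a : Fin d → ℝ) (h0 : multiplicityAt a 0 ≤ 1) :
    (squares a).ncard = (oppositeModuli a).ncard + (imaginaryModuli a).ncard := by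
  have hf := squares_finite a
  rw [squares_eq a h0] at hf ⊢
  rw [Set.ncard_union_eq _ (hf.subset Set.subset_union_left) (hf.subset Set.subset_union_right),
    Set.InjOn.ncard_image, Set.InjOn.ncard_image]
  · intro x hx y hy h
    have h' : x ^ 2 = y ^ 2 := neg_injective h
    exact (pow_left_inj₀ hx.1.le hy.1.le two_ne_zero).1 h'
  · intro x hx y hy h
    exact (pow_left_inj₀ hx.1.le hy.1.le two_ne_zero).1 h
  · rw [Set.disjoint_left]
    rintro _ ⟨v, hv, rfl⟩ ⟨w, hw, h⟩
    have := hv.1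
    have := hw.1
    simp only at h
    nlinarith

lemma abs_le_of_mem_squares {a : Fin d → ℝ} {t : ℝ} (ht : t ∈ squares a) :
    |t| ≤ (‖a‖ + 1) ^ 2 := by
  obtain ⟨z, hz⟩ := IsAlgClosed.exists_pow_nat_eq (t : ℂ) two_pos
  have hr : ((Q a).map (algebraMap ℝ ℂ)).IsRoot z := by
    rw [← dvd_iff_isRoot]
    refine Dvd.dvd.trans ?_ ((map_dvd_map' (algebraMap ℝ ℂ)).2 ht)
    rw [dvd_iff_isRoot]
    simp [hz]
  have hm := (Q_monic a).map (algebraMap ℝ ℂ)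
  have hb : cauchyBound ((Q a).map (algebraMap ℝ ℂ)) ≤ ‖a‖₊ + 1 := by
    rw [cauchyBound, hm.leadingCoeff, nnnorm_one, div_one]
    gcongr
    refine Finset.sup_le fun i hi => ?_
    rw [natDegree_map, natDegree_Q, Finset.mem_range] at hi
    rw [coeff_map, show (Q a).coeff i = a ⟨i, hi⟩ from Q_coeff a ⟨i, hi⟩]
    simpa using nnnorm_le_pi_nnnorm a ⟨i, hi⟩
  have h1 : ‖z‖ ≤ ‖a‖ + 1 := by
    have := (hr.norm_lt_cauchyBound hm.ne_zero).le.trans hb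
    exact_mod_cast this
  calc |t| = ‖z‖ ^ 2 := by rw [← norm_pow, hz]; simp
    _ ≤ _ := by gcongr

lemma complexRoots_eq (a : Fin d → ℝ) :
    complexRoots a = ((Q a).map (algebraMap ℝ ℂ)).roots.toFinset := by
  ext z
  rw [Finset.mem_coe, Multiset.mem_toFinset, mem_roots ((Q_monic a).map _).ne_zero, IsRoot.def,
    eval_map_algebraMap]
  rfl

lemma card_roots_map_Q (a : Fin d → ℝ) :
    Multiset.card ((Q a).map (algebraMap ℝ ℂ)).roots = d := by
  rw [← (IsAlgClosed.splits ((Q a).map (algebraMap ℝ ℂ))).natDegree_eq_card_roots, natDegree_map,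
    natDegree_Q]

lemma multiplicityAt_le_one {a : Fin d → ℝ} (h : (complexRoots a).ncard = d) (z : ℂ) :
    multiplicityAt a z ≤ 1 := by
  rw [complexRoots_eq, Set.ncard_coe_finset] at h
  rw [multiplicityAt, ← count_roots]
  refine Multiset.nodup_iff_count_le_one.1 ?_ z
  rw [← Multiset.toFinset_card_eq_card_iff_nodup, h, card_roots_map_Q]

lemma complexRoots_eq_image {a : Fin d → ℝ} (h : (realRoots a).ncard = d) :
    complexRoots a = (fun x : ℝ => (x : ℂ)) '' realRoots a := by
  symm
  have hfin : (complexRoots a).Finite := by rw [complexRoots_eq]; exact Finset.finite_toSet _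
  refine Set.eq_of_subset_of_ncard_le ?_ ?_ hfin
  · rintro _ ⟨x, hx, rfl⟩
    exact (ofReal_mem_complexRoots_iff a x).2 hx
  · rw [Set.ncard_image_of_injective _ Complex.ofReal_injective, h, complexRoots_eq,
      Set.ncard_coe_finset]
    exact (Multiset.toFinset_card_le _).trans (card_roots_map_Q a).le

lemma ncard_complexRoots {a : Fin d → ℝ} (h : (realRoots a).ncard = d) :
    (complexRoots a).ncard = d := by
  rw [complexRoots_eq_image h, Set.ncard_image_of_injective _ Complex.ofReal_injective, h]

lemma imaginaryModuli_eq_empty {a : Fin d → ℝ} (h : (realRoots a).ncard = d) :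
    imaginaryModuli a = ∅ := by
  refine Set.eq_empty_iff_forall_notMem.2 fun w ⟨hw, hw', _⟩ => ?_
  rw [complexRoots_eq_image h] at hw'
  obtain ⟨x, -, hx⟩ := hw'
  have := congrArg Complex.im hx
  simp at this
  exact hw.ne this

lemma X_sub_C_sq_dvd {P : ℝ[X]} {t : ℝ} (h : P.eval t = 0) (h' : (derivative P).eval t = 0) :
    (X - C t) ^ 2 ∣ P := by
  obtain ⟨g, rfl⟩ := dvd_iff_isRoot.2 h
  have hg : g.eval t = 0 := by simpa [derivative_mul] using h'
  rw [pow_two]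
  exact mul_dvd_mul_left _ (dvd_iff_isRoot.2 hg)

/-- At a common root that is simple for `Q a`, even and odd part are not both stationary. -/
lemma derivative_ne_zero_or {a : Fin d → ℝ} {t : ℝ} (ht : t ∈ squares a)
    (h : ¬ (X ^ 2 - C t) ^ 2 ∣ Q a) :
    (derivative (evenPart (Q a))).eval t ≠ 0 ∨ (derivative (oddPart (Q a))).eval t ≠ 0 := by
  rw [mem_squares_iff] at ht
  by_contra! hc
  exact h ((X_sq_sub_C_pow_dvd_iff _ _ _).2
    ⟨X_sub_C_sq_dvd ht.1 hc.1, X_sub_C_sq_dvd ht.2 hc.2⟩)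

end Polynomials

/-! ### Implicit functions and submersions -/

section Analysis

variable {V : Type*} [NormedAddCommGroup V] [NormedSpace ℝ V] [FiniteDimensional ℝ V]
variable {W : Type*} [NormedAddCommGroup W] [NormedSpace ℝ W] [FiniteDimensional ℝ W]
variable {Z : Type*} [NormedAddCommGroup Z] [NormedSpace ℝ Z] [FiniteDimensional ℝ Z]

lemma exists_continuousLinearEquiv_of_injective {L : V →L[ℝ] W} (hL : Function.Injective L)
    (h : Module.finrank ℝ V = Module.finrank ℝ W) : ∃ e : V ≃L[ℝ] W, (e : V →L[ℝ] W) = L := by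
  refine ⟨(LinearMap.linearEquivOfInjective (L : V →ₗ[ℝ] W) hL h).toContinuousLinearEquiv, ?_⟩
  ext x
  simp

/-- The implicit function theorem for an equation `f = 0`, with the derivative of the solution
described by the linearized equation. -/
lemma exists_implicit_function {f : V × W → Z} {p : V} {w : W} (hf : ContDiffAt ℝ ω f (p, w))
    (h0 : f (p, w) = 0) (hinj : ∀ k, fderiv ℝ f (p, w) (0, k) = 0 → k = 0)
    (hdim : Module.finrank ℝ W = Module.finrank ℝ Z) :
    ∃ (g : V → W) (g' : V →L[ℝ] W), ContDiffAt ℝ ω g p ∧ g p = w ∧ HasFDerivAt g g' p ∧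
      (∀ h, fderiv ℝ f (p, w) (h, g' h) = 0) ∧
      ∀ᶠ v in 𝓝 (p, w), f v = 0 ↔ g v.1 = v.2 := by
  have hinv : (fderiv ℝ f (p, w) ∘L .inr ℝ V W).IsInvertible :=
    exists_continuousLinearEquiv_of_injective
      ((injective_iff_map_eq_zero _).2 fun k hk => hinj k (by simpa using hk)) hdim
  have hω : (ω : WithTop ℕ∞) ≠ 0 := by simp
  have hc := hf.contDiffAt_implicitFunction hω hinv
  have hg := hf.implicitFunction_apply_self hω hinv
  have hev := hf.eventually_apply_implicitFunction hω hinv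
  have hiff := hf.eventually_apply_eq_iff_implicitFunction hω hinv
  set g := hf.implicitFunction hω hinv
  have hg' := (hc.differentiableAt hω).hasFDerivAt
  refine ⟨g, fderiv ℝ g p, hc, hg, hg', fun h => ?_, by simpa only [h0] using hiff⟩
  have hf' : HasFDerivAt f (fderiv ℝ f (p, w)) (p, g p) := by
    rw [show g p = w from hg]; exact (hf.differentiableAt hω).hasFDerivAt
  have h1 := hf'.comp p ((hasFDerivAt_id p).prodMk hg')
  have h2 : HasFDerivAt (f ∘ fun x => (id x, g x)) (0 : V →L[ℝ] Z) p :=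
    (hasFDerivAt_const (0 : Z) p).congr_of_eventuallyEq
      (by filter_upwards [hev] with a ha; simpa [h0] using ha)
  simpa using DFunLike.congr_fun (h1.unique h2) h

/-- If `t₀` is a common zero of `A p` and `B p`, simple for `B p`, then for `a` near `p` the
functions `A a` and `B a` have a common zero near `t₀` if and only if `A a` vanishes at the zero
of `B a` near `t₀`. -/
lemma exists_equation_of_simple_zero {A B : V × ℝ → ℝ} {p : V} {t₀ : ℝ}
    (hA : ContDiffAt ℝ ω A (p, t₀)) (hB : ContDiffAt ℝ ω B (p, t₀))
    (hA0 : A (p, t₀) = 0) (hB0 : B (p, t₀) = 0) (hB1 : fderiv ℝ B (p, t₀) (0, 1) ≠ 0) :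
    ∃ f : V → ℝ, ContDiffAt ℝ ω f p ∧ f p = 0 ∧
      (∃ c ≠ 0, ∀ h, fderiv ℝ f p h = c * (fderiv ℝ B (p, t₀) (0, 1) * fderiv ℝ A (p, t₀) (h, 0) -
        fderiv ℝ A (p, t₀) (0, 1) * fderiv ℝ B (p, t₀) (h, 0))) ∧
      ∃ N ∈ 𝓝 t₀, ∀ᶠ a in 𝓝 p, f a = 0 ↔ ∃ t ∈ N, A (a, t) = 0 ∧ B (a, t) = 0 := by
  have hω : (ω : WithTop ℕ∞) ≠ 0 := by simp
  have split (T : V × ℝ →L[ℝ] ℝ) (h : V) (k : ℝ) : T (h, k) = T (h, 0) + k * T (0, 1) := by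
    rw [← smul_eq_mul, ← map_smul, ← map_add]; simp
  obtain ⟨g, g', hg, hgp, hg', hlin, hiff⟩ := exists_implicit_function hB hB0
    (fun k hk => by simpa [split _ 0 k, Prod.mk_zero_zero, hB1] using hk) rfl
  obtain ⟨P, hP, N, hN, hPN⟩ := eventually_prod_iff.1 (nhds_prod_eq (x := p) (y := t₀) ▸ hiff)
  have hA' : HasFDerivAt A (fderiv ℝ A (p, t₀)) (p, g p) := by
    rw [hgp]; exact (hA.differentiableAt hω).hasFDerivAt
  have hf' := hA'.comp p ((hasFDerivAt_id p).prodMk hg')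
  refine ⟨A ∘ fun a => (a, g a), ?_, by simp [hgp, hA0],
    ⟨(fderiv ℝ B (p, t₀) (0, 1))⁻¹, inv_ne_zero hB1, fun h => ?_⟩, {t | N t}, hN, ?_⟩
  · exact ContDiffAt.comp p (by rwa [hgp]) (contDiffAt_id.prodMk hg)
  · have e := hlin h
    rw [split] at e
    have e2 : fderiv ℝ (A ∘ fun a => (a, g a)) p h = fderiv ℝ A (p, t₀) (h, g' h) := by
      have := DFunLike.congr_fun hf'.fderiv h
      simpa using this
    rw [e2, split]
    have e3 : g' h = - (fderiv ℝ B (p, t₀) (h, 0)) / fderiv ℝ B (p, t₀) (0, 1) := by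
      rw [eq_div_iff hB1]; linarith
    rw [e3]; field_simp; ring
  · filter_upwards [hP, hg.continuousAt.eventually (by rw [hgp]; exact hN)] with a ha hga
    constructor
    · intro h
      exact ⟨g a, hga, h, (hPN ha hga).2 rfl⟩
    · rintro ⟨t, ht, h1, h2⟩
      have := (hPN ha ht).1 h2
      simp only at this
      simpa [this] using h1

/-- The roles of the two functions in `exists_equation_of_simple_zero` are interchangeable. -/
lemma exists_equation_of_common_zero {A B : V × ℝ → ℝ} {p : V} {t₀ : ℝ}
    (hA : ContDiffAt ℝ ω A (p, t₀)) (hB : ContDiffAt ℝ ω B (p, t₀))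
    (hA0 : A (p, t₀) = 0) (hB0 : B (p, t₀) = 0)
    (h1 : fderiv ℝ A (p, t₀) (0, 1) ≠ 0 ∨ fderiv ℝ B (p, t₀) (0, 1) ≠ 0) :
    ∃ f : V → ℝ, ContDiffAt ℝ ω f p ∧ f p = 0 ∧
      (∃ c ≠ 0, ∀ h, fderiv ℝ f p h = c * (fderiv ℝ B (p, t₀) (0, 1) * fderiv ℝ A (p, t₀) (h, 0) -
        fderiv ℝ A (p, t₀) (0, 1) * fderiv ℝ B (p, t₀) (h, 0))) ∧
      ∃ N ∈ 𝓝 t₀, ∀ᶠ a in 𝓝 p, f a = 0 ↔ ∃ t ∈ N, A (a, t) = 0 ∧ B (a, t) = 0 := by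
  rcases h1 with h1 | h1
  · obtain ⟨f, hf, hfp, ⟨c, hc, hd⟩, N, hN, hi⟩ := exists_equation_of_simple_zero hB hA hB0 hA0 h1
    refine ⟨f, hf, hfp, ⟨-c, neg_ne_zero.2 hc, fun h => ?_⟩, N, hN, ?_⟩
    · rw [hd]; ring
    · simpa only [and_comm] using hi
  · exact exists_equation_of_simple_zero hA hB hA0 hB0 h1

/-- A submersion at `p` can be completed to a local diffeomorphism, which straightens the
preimages of sets. -/
lemma isLocallyDiffeomorphic_preimage {F : V → W} {p : V} {n : ℕ} (hF : ContDiffAt ℝ ω F p)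
    (hFp : F p = 0) (hsurj : Function.Surjective (fderiv ℝ F p))
    (hdim : Module.finrank ℝ V = n + Module.finrank ℝ W) {S : Set V} {T : Set W}
    (hST : ∀ᶠ a in 𝓝 p, a ∈ S ↔ F a ∈ T) :
    IsLocallyDiffeomorphic S p ((Set.univ : Set (Fin n → ℝ)) ×ˢ T) (0, 0) := by
  have hω : (ω : WithTop ℕ∞) ≠ 0 := by simp
  set L := fderiv ℝ F p
  have hker : Module.finrank ℝ (LinearMap.ker (L : V →ₗ[ℝ] W)) = n := by
    have h1 := LinearMap.finrank_range_add_finrank_ker (L : V →ₗ[ℝ] W)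
    rw [LinearMap.range_eq_top.2 hsurj, finrank_top] at h1
    omega
  obtain ⟨P, hP⟩ := LinearMap.exists_leftInverse_of_injective
    (LinearMap.ker (L : V →ₗ[ℝ] W)).subtype (Submodule.ker_subtype _)
  let e : LinearMap.ker (L : V →ₗ[ℝ] W) ≃ₗ[ℝ] (Fin n → ℝ) :=
    LinearEquiv.ofFinrankEq _ _ (by simp [hker])
  let M : V →L[ℝ] (Fin n → ℝ) := LinearMap.toContinuousLinearMap (e.toLinearMap ∘ₗ P)
  have hML : Function.Injective (M.prod L) := by
    refine (injective_iff_map_eq_zero _).2 fun h hh => ?_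
    obtain ⟨h1, h2⟩ := Prod.mk.inj hh
    have h3 : P h = 0 := e.map_eq_zero_iff.1 h1
    have h4 := DFunLike.congr_fun hP ⟨h, h2⟩
    simp only [LinearMap.comp_apply, Submodule.subtype_apply, h3, LinearMap.id_apply] at h4
    exact (congrArg Subtype.val h4).symm
  obtain ⟨D, hD⟩ := exists_continuousLinearEquiv_of_injective hML (by simp [hdim])
  have hΦ : ContDiffAt ℝ ω (fun a => (M (a - p), F a)) p :=
    (M.contDiff.contDiffAt.comp p (contDiffAt_id.sub contDiffAt_const)).prodMk hF
  have hΦ' : HasFDerivAt (fun a => (M (a - p), F a)) (D : V →L[ℝ] (Fin n → ℝ) × W) p := by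
    rw [hD]
    exact (M.hasFDerivAt.comp p ((hasFDerivAt_id p).sub_const p)).prodMk
      (hF.differentiableAt hω).hasFDerivAt
  let ψ := hΦ.toOpenPartialHomeomorph _ hΦ' hω
  have hψ : (ψ : V → (Fin n → ℝ) × W) = fun a => (M (a - p), F a) := rfl
  have hpψ : p ∈ ψ.source := hΦ.mem_toOpenPartialHomeomorph_source hΦ' hω
  have hψs : ContDiffAt ℝ ω ψ.symm (ψ p) :=
    ψ.contDiffAt_symm (f₀' := D) (ψ.map_source hpψ) (by rwa [ψ.left_inv hpψ])
      (by rwa [ψ.left_inv hpψ])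
  obtain ⟨O, hO, hOo, hpO⟩ := mem_nhds_iff.1 hST
  have hω' : (ω : WithTop ℕ∞) ≠ ∞ := by simp
  let χ := (ψ.restrContDiff ℝ ω hω').restrOpen O hOo
  have hχ : χ.source ⊆ (ψ.restrContDiff ℝ ω hω').source := fun x hx => hx.1
  have hχt : χ.target ⊆ (ψ.restrContDiff ℝ ω hω').target := fun x hx => hx.1
  refine ⟨χ, ⟨⟨hpψ, hΦ, hψs⟩, hpO⟩, ?_, ?_, ?_, ?_⟩
  · change (M (p - p), F p) = (0, 0)
    simp [hFp]
  · exact ((ψ.contDiffOn_restrContDiff_source ℝ hω').mono hχ).of_le (by simp)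
  · exact ((ψ.contDiffOn_restrContDiff_target ℝ hω').mono hχt).of_le (by simp)
  · ext y
    constructor
    · rintro ⟨a, ⟨haS, ha⟩, rfl⟩
      exact ⟨⟨trivial, (hO ha.2).1 haS⟩, χ.map_source ha⟩
    · rintro ⟨⟨-, hyT⟩, hy⟩
      have ha := χ.map_target hy
      have hya : χ (χ.symm y) = y := χ.right_inv hy
      refine ⟨χ.symm y, ⟨(hO ha.2).2 ?_, ha⟩, hya⟩
      rw [← hya] at hyT
      exact hyT

/-- Suppose that, along a parameter `w = (m, n)`, functions `f` and `k` with two components vanish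
at `(p, w)`, that `f = 0` can be solved for `w = g(a)`, and that the derivatives of `f` and `k` with
respect to `a` are jointly surjective. Then `a ↦ (-k₂, k₁, n)`, taken at `w = g(a)`, is a submersion
at `p`. -/
lemma exists_submersion {f k : V × (ℝ × ℝ) → ℝ × ℝ} {p : V} {m₀ : ℝ}
    (hf : ContDiffAt ℝ ω f (p, (m₀, 0))) (hk : ContDiffAt ℝ ω k (p, (m₀, 0)))
    (hf0 : f (p, (m₀, 0)) = 0) (hk0 : k (p, (m₀, 0)) = 0)
    (hinj : ∀ w, fderiv ℝ f (p, (m₀, 0)) (0, w) = 0 → w = 0)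
    (hsurj : ∀ y z, ∃ h, fderiv ℝ f (p, (m₀, 0)) (h, 0) = y ∧ fderiv ℝ k (p, (m₀, 0)) (h, 0) = z) :
    ∃ g : V → ℝ × ℝ, ContDiffAt ℝ ω g p ∧ g p = (m₀, 0) ∧ (∀ᶠ a in 𝓝 p, f (a, g a) = 0) ∧
      ∃ F : V → Fin 3 → ℝ, (∀ a, F a = ![-(k (a, g a)).2, (k (a, g a)).1, (g a).2]) ∧
        ContDiffAt ℝ ω F p ∧ F p = 0 ∧ Function.Surjective (fderiv ℝ F p) := by
  have hω : (ω : WithTop ℕ∞) ≠ 0 := by simp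
  obtain ⟨g, g', hg, hgp, hg', hlin, hiff⟩ := exists_implicit_function hf hf0 hinj rfl
  have hcont : Tendsto (fun a => (a, g a)) (𝓝 p) (𝓝 (p, (m₀, 0))) := by
    rw [← hgp]; exact continuousAt_id.prodMk hg.continuousAt
  have hK : ContDiffAt ℝ ω (fun a => k (a, g a)) p :=
    ContDiffAt.comp p (g := k) (f := fun a => (a, g a)) (by rwa [hgp]) (contDiffAt_id.prodMk hg)
  have hK' : HasFDerivAt (fun a => k (a, g a))
      ((fderiv ℝ k (p, (m₀, 0))).comp ((ContinuousLinearMap.id ℝ V).prod g')) p := by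
    have h1 : HasFDerivAt k (fderiv ℝ k (p, (m₀, 0))) (p, g p) := by
      rw [hgp]; exact (hk.differentiableAt hω).hasFDerivAt
    exact h1.comp p ((hasFDerivAt_id p).prodMk hg')
  set K' := (fderiv ℝ k (p, (m₀, 0))).comp ((ContinuousLinearMap.id ℝ V).prod g')
  have hF' : HasFDerivAt (fun a => ![-(k (a, g a)).2, (k (a, g a)).1, (g a).2])
      (ContinuousLinearMap.pi ![-((ContinuousLinearMap.snd ℝ ℝ ℝ).comp K'),
        (ContinuousLinearMap.fst ℝ ℝ ℝ).comp K', (ContinuousLinearMap.snd ℝ ℝ ℝ).comp g']) p := by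
    refine hasFDerivAt_pi.2 fun i => ?_
    fin_cases i
    · exact hK'.snd.neg
    · exact hK'.fst
    · exact hg'.snd
  refine ⟨g, hg, hgp, ?_, _, fun a => rfl, ?_, ?_, ?_⟩
  · filter_upwards [hcont.eventually hiff] with a ha
    exact ha.2 rfl
  · refine contDiffAt_pi.2 fun i => ?_
    fin_cases i
    · exact hK.snd.neg
    · exact hK.fst
    · exact hg.snd
  · ext i
    fin_cases i <;> simp [hgp, hk0]
  · rw [hF'.fderiv]
    intro y
    obtain ⟨h, h1, h2⟩ := hsurj (-fderiv ℝ f (p, (m₀, 0)) (0, (0, y 2)))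
      ((y 1, -y 0) - fderiv ℝ k (p, (m₀, 0)) (0, (0, y 2)))
    have split (T : V × (ℝ × ℝ) →L[ℝ] ℝ × ℝ) (w : ℝ × ℝ) : T (h, w) = T (h, 0) + T (0, w) := by
      rw [← map_add]; simp
    have hgh : g' h = (0, y 2) := by
      refine sub_eq_zero.1 (hinj _ ?_)
      have e : ((0 : V), g' h - (0, y 2)) = (0, g' h) - (0, (0, y 2)) := by simp
      have := hlin h
      rw [split, h1] at this
      rw [e, map_sub, ← this]
      abel
    have hKh : K' h = (y 1, -y 0) := by
      change fderiv ℝ k (p, (m₀, 0)) (h, g' h) = _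
      rw [hgh, split, h2]; abel
    refine ⟨h, ?_⟩
    ext i
    fin_cases i <;> simp [hKh, hgh]

end Analysis

/-! ### The family of polynomials near a point -/

section Family

variable {d : ℕ} (Λ : ℝ[X] →ₗ[ℝ] ℝ[X])

lemma eval_map_Q (a : Fin d → ℝ) (t : ℝ) :
    (Λ (Q a)).eval t = (Λ (X ^ d)).eval t + ∑ j : Fin d, a j * (Λ (X ^ (j : ℕ))).eval t := by
  rw [Q_eq, map_add, eval_add, lowerPart, map_sum, eval_finsetSum]
  simp

/-- The joint evaluation `(a, t) ↦ (Λ Q_a)(t)`, where `Λ` will be the even or the odd part. -/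
def evalFamily (x : (Fin d → ℝ) × ℝ) : ℝ := (Λ (Q x.1)).eval x.2

lemma contDiff_evalFamily : ContDiff ℝ ω (evalFamily Λ : (Fin d → ℝ) × ℝ → ℝ) := by
  have h (P : ℝ[X]) : ContDiff ℝ ω fun x : (Fin d → ℝ) × ℝ => P.eval x.2 :=
    by
    simpa [Function.comp_def] using (P.contDiff_aeval (𝕜 := ℝ) ω).comp (contDiff_snd (E := Fin d → ℝ) (F := ℝ))
  have e : (evalFamily Λ : (Fin d → ℝ) × ℝ → ℝ) = fun x => (Λ (X ^ d)).eval x.2 +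
      ∑ j : Fin d, x.1 j * (Λ (X ^ (j : ℕ))).eval x.2 := funext fun x => eval_map_Q Λ x.1 x.2
  rw [e]
  refine (h _).add (ContDiff.sum fun j _ => ContDiff.mul ?_ (h _))
  exact (contDiff_apply ℝ ℝ j).comp contDiff_fst

lemma map_Q_add_smul (p h : Fin d → ℝ) (s : ℝ) :
    Λ (Q (p + s • h)) = Λ (Q p) + s • Λ (lowerPart h) := by
  have : lowerPart (p + s • h) = lowerPart p + s • lowerPart h := by
    simp [lowerPart, add_smul, Finset.sum_add_distrib, Finset.smul_sum, mul_smul]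
  rw [Q_eq, Q_eq, this, ← add_assoc, map_add, map_smul]

lemma fderiv_apply_eq_of_hasDerivAt {V W : Type*} [NormedAddCommGroup V] [NormedSpace ℝ V]
    [NormedAddCommGroup W] [NormedSpace ℝ W] {f : V → W} {x v : V} {y : W}
    (hf : DifferentiableAt ℝ f x) (h : HasDerivAt (fun s : ℝ => f (x + s • v)) y 0) :
    fderiv ℝ f x v = y := by
  have h1 : HasDerivAt (fun s : ℝ => x + s • v) v 0 := by
    simpa using ((hasDerivAt_id (0 : ℝ)).smul_const v).const_add x
  have h2 : HasFDerivAt f (fderiv ℝ f x) (x + (0 : ℝ) • v) := by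
    simpa using hf.hasFDerivAt
  exact (h2.comp_hasDerivAt 0 h1).unique h

lemma fderiv_evalFamily_left (p h : Fin d → ℝ) (t : ℝ) :
    fderiv ℝ (evalFamily Λ) (p, t) (h, 0) = (Λ (lowerPart h)).eval t := by
  refine fderiv_apply_eq_of_hasDerivAt
    ((contDiff_evalFamily Λ).differentiable (by simp)).differentiableAt ?_
  have e : (fun s : ℝ => evalFamily Λ ((p, t) + s • (h, 0)))
      = fun s => (Λ (Q p)).eval t + s * (Λ (lowerPart h)).eval t := by
    funext s
    simp [evalFamily, map_Q_add_smul]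
  rw [e]
  simpa using ((hasDerivAt_id (0 : ℝ)).mul_const ((Λ (lowerPart h)).eval t)).const_add
    ((Λ (Q p)).eval t)

lemma fderiv_evalFamily_right (p : Fin d → ℝ) (t : ℝ) :
    fderiv ℝ (evalFamily Λ) (p, t) (0, 1) = (derivative (Λ (Q p))).eval t := by
  refine fderiv_apply_eq_of_hasDerivAt
    ((contDiff_evalFamily Λ).differentiable (by simp)).differentiableAt ?_
  have e : (fun s : ℝ => evalFamily Λ ((p, t) + s • (0, 1)))
      = fun s => (Λ (Q p)).eval (t + s) := by
    funext s
    simp [evalFamily]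
  rw [e]
  have := (Λ (Q p)).hasDerivAt (t + 0)
  simpa using this.comp_const_add t 0

lemma mem_squares_iff_evalFamily (a : Fin d → ℝ) (t : ℝ) :
    t ∈ squares a ↔ evalFamily evenPart (a, t) = 0 ∧ evalFamily oddPart (a, t) = 0 :=
  mem_squares_iff a t

/-- The set `squares a` depends upper semicontinuously on `a`: the common roots of the two parts
stay bounded while `a` does. -/
lemma eventually_squares_subset (p : Fin d → ℝ) {N : Set ℝ} (hN : IsOpen N)
    (hp : squares p ⊆ N) : ∀ᶠ a in 𝓝 p, squares a ⊆ N := by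
  have hK : IsCompact (Metric.closedBall (0 : ℝ) ((‖p‖ + 1 + 1) ^ 2) \ N) :=
    (isCompact_closedBall _ _).diff hN
  have h1 : ∀ᶠ a in 𝓝 p, ∀ t ∈ Metric.closedBall (0 : ℝ) ((‖p‖ + 1 + 1) ^ 2) \ N,
      t ∉ squares a := by
    refine hK.eventually_forall_of_forall_eventually fun t ht => ?_
    have hcl : IsClosed {x : (Fin d → ℝ) × ℝ | evalFamily evenPart x = 0 ∧
        evalFamily oddPart x = 0} :=
      (isClosed_eq (contDiff_evalFamily _).continuous continuous_const).inter
        (isClosed_eq (contDiff_evalFamily _).continuous continuous_const)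
    have hm : (p, t) ∉ {x : (Fin d → ℝ) × ℝ | evalFamily evenPart x = 0 ∧
        evalFamily oddPart x = 0} := fun h => ht.2 (hp ((mem_squares_iff_evalFamily p t).2 h))
    filter_upwards [hcl.isOpen_compl.mem_nhds hm] with x hx hx'
    exact hx ((mem_squares_iff_evalFamily _ _).1 hx')
  have h2 : ∀ᶠ a in 𝓝 p, ‖a‖ < ‖p‖ + 1 :=
    continuous_norm.continuousAt.eventually_lt continuousAt_const (by simp)
  filter_upwards [h1, h2] with a ha ha' t ht
  by_contra htN
  refine ha t ⟨?_, htN⟩ ht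
  rw [mem_closedBall_zero_iff, Real.norm_eq_abs]
  refine (abs_le_of_mem_squares ht).trans ?_
  gcongr

/-- Small perturbations of `Q` have arbitrary even and odd parts, subject to the degree bound. -/
lemma exists_evenPart_oddPart_eq {u w : ℝ[X]} {m : ℕ} (hu : u.natDegree ≤ m)
    (hw : w.natDegree ≤ m) (hm : 2 * m + 1 < d) :
    ∃ h : Fin d → ℝ, evenPart (lowerPart h) = u ∧ oddPart (lowerPart h) = w := by
  have hdeg : (expand ℝ 2 u + X * expand ℝ 2 w).degree < (d : WithBot ℕ) := by
    have hle : (expand ℝ 2 u + X * expand ℝ 2 w).natDegree ≤ 2 * m + 1 := by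
      refine natDegree_add_le_of_degree_le ?_ ?_
      · rw [natDegree_expand]; omega
      · refine natDegree_mul_le.trans ?_
        rw [natDegree_expand, natDegree_X]; omega
    exact (degree_le_of_natDegree_le hle).trans_lt (Nat.cast_lt.2 hm)
  obtain ⟨h, hh⟩ := exists_lowerPart_eq _ hdeg
  exact ⟨h, by rw [hh, evenPart_expand_add], by rw [hh, oddPart_expand_add]⟩

/-- Covectors `h ↦ α_i A_h(t_i) + β_i B_h(t_i)`, where `A_h` and `B_h` are the even and the odd part
of the direction `h`, are independent for distinct `t_i` if the degree is large enough. -/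
lemma linearIndependent_of_apply_eq {s : ℕ} (hs : 2 * s ≤ d) {t : Fin s → ℝ}
    (ht : Function.Injective t) {T : Fin s → (Fin d → ℝ) →L[ℝ] ℝ} {α β : Fin s → ℝ}
    (h0 : ∀ i, α i ≠ 0 ∨ β i ≠ 0)
    (hT : ∀ i h, T i h = α i * (evenPart (lowerPart h)).eval (t i) +
      β i * (oddPart (lowerPart h)).eval (t i)) : LinearIndependent ℝ T := by
  classical
  rw [linearIndependent_iff']
  intro S c hc i hi
  let π : ℝ[X] := ∏ j ∈ Finset.univ.erase i, (X - C (t j))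
  have hπdeg : π.natDegree ≤ s - 1 := by
    rw [natDegree_prod_of_monic _ _ fun j _ => monic_X_sub_C _]
    simp
  have hs0 : 0 < s := i.pos
  obtain ⟨h, he, ho⟩ := exists_evenPart_oddPart_eq (d := d) (u := C (α i) * π) (w := C (β i) * π)
    ((natDegree_C_mul_le _ _).trans hπdeg) ((natDegree_C_mul_le _ _).trans hπdeg) (by omega)
  have hval (j : Fin s) : T j h = (α j * α i + β j * β i) * π.eval (t j) := by
    rw [hT, he, ho]; simp; ring
  have hπ0 : π.eval (t i) ≠ 0 := by
    rw [eval_prod]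
    refine Finset.prod_ne_zero_iff.2 fun j hj => ?_
    simpa [sub_eq_zero] using fun h => Finset.ne_of_mem_erase hj (ht h.symm)
  have hπj (j : Fin s) (hj : j ≠ i) : π.eval (t j) = 0 := by
    rw [eval_prod]
    exact Finset.prod_eq_zero (Finset.mem_erase.2 ⟨hj, Finset.mem_univ j⟩) (by simp)
  have hsum := DFunLike.congr_fun hc h
  rw [_root_.sum_apply, Finset.sum_eq_single i] at hsum
  · have hpos : α i * α i + β i * β i ≠ 0 := by
      intro hz
      rcases h0 i with h | h <;> nlinarith [mul_self_pos.2 h, mul_self_nonneg (α i), mul_self_nonneg (β i)]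
    simpa [hval, hπ0, hpos] using hsum
  · intro j _ hj
    simp [hval, hπj j hj]
  · exact fun h => absurd hi h

/-- If all common roots `t` of the even and odd part of `Q p` are simple, then the set of those
`a` which have such common roots is near `p` a union of transversal hypersurfaces, one for
each `t`. -/
lemma isLocallyTransversalCrossing_of_simple {S : Set (Fin d → ℝ)} {p : Fin d → ℝ} {s : ℕ}
    (hS : ∀ᶠ a in 𝓝 p, a ∈ S ↔ (squares a).Nonempty)
    (hsimple : ∀ t ∈ squares p, ¬ (X ^ 2 - C t) ^ 2 ∣ Q p) (hs : (squares p).ncard = s) :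
    IsLocallyTransversalCrossing S p s := by
  have hω : (ω : WithTop ℕ∞) ≠ 0 := by simp
  have hfin := squares_finite p
  have := hfin.to_subtype
  let e : Fin s ≃ squares p := (Finite.equivFinOfCardEq hs).symm
  let t : Fin s → ℝ := fun i => e i
  have hinj : Function.Injective t := Subtype.val_injective.comp e.injective
  have htmem (i : Fin s) : t i ∈ squares p := (e i).2
  have hex (i : Fin s) := exists_equation_of_common_zero (t₀ := t i) (p := p)
    (contDiff_evalFamily evenPart).contDiffAt (contDiff_evalFamily oddPart).contDiffAt
    ((mem_squares_iff_evalFamily _ _).1 (htmem i)).1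
    ((mem_squares_iff_evalFamily _ _).1 (htmem i)).2
    (by
      rw [fderiv_evalFamily_right, fderiv_evalFamily_right]
      exact derivative_ne_zero_or (htmem i) (hsimple _ (htmem i)))
  simp only [fderiv_evalFamily_left, fderiv_evalFamily_right] at hex
  choose f hf hfp hcd N hN hfN using hex
  choose c hc hd using hcd
  have h2s : 2 * s ≤ d := by
    have := two_mul_card_le p hfin.toFinset (by simp)
    rwa [← Set.ncard_eq_toFinset_card _ hfin, hs] at this
  have hli : LinearIndependent ℝ fun i => fderiv ℝ (f i) p := by
    refine linearIndependent_of_apply_eq h2s hinj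
      (α := fun i => c i * (derivative (oddPart (Q p))).eval (t i))
      (β := fun i => - (c i * (derivative (evenPart (Q p))).eval (t i))) (fun i => ?_)
      fun i h => by rw [hd]; ring
    rcases derivative_ne_zero_or (htmem i) (hsimple _ (htmem i)) with h | h
    · exact Or.inr (neg_ne_zero.2 (mul_ne_zero (hc i) h))
    · exact Or.inl (mul_ne_zero (hc i) h)
  have hsub : ∀ᶠ a in 𝓝 p, squares a ⊆ ⋃ i, interior (N i) := by
    refine eventually_squares_subset p (isOpen_iUnion fun i => isOpen_interior) fun u hu => ?_
    refine Set.mem_iUnion.2 ⟨e.symm ⟨u, hu⟩, ?_⟩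
    have : t (e.symm ⟨u, hu⟩) = u := by simp [t]
    have h := mem_interior_iff_mem_nhds.2 (hN (e.symm ⟨u, hu⟩))
    rwa [this] at h
  have hreg (i : Fin s) : ∀ᶠ a in 𝓝 p, fderiv ℝ (f i) a ≠ 0 := by
    have hcont : ContinuousAt (fderiv ℝ (f i)) p :=
      ((hf i).fderiv_right (m := 0) (by simp)).continuousAt
    exact hcont.eventually_ne (hli.ne_zero i)
  have hall : ∀ᶠ a in 𝓝 p, (∀ i, ContDiffAt ℝ ω (f i) a ∧ fderiv ℝ (f i) a ≠ 0) ∧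
      (a ∈ S ↔ ∃ i, f i a = 0) := by
    filter_upwards [hS, hsub, eventually_all.2 hfN, eventually_all.2 hreg,
      eventually_all.2 fun i => (hf i).eventually (by simp)] with a h1 h2 h3 h4 h5
    refine ⟨fun i => ⟨h5 i, h4 i⟩, h1.trans ⟨?_, ?_⟩⟩
    · rintro ⟨u, hu⟩
      obtain ⟨i, hi⟩ := Set.mem_iUnion.1 (h2 hu)
      exact ⟨i, (h3 i).2 ⟨u, interior_subset hi, (mem_squares_iff_evalFamily _ _).1 hu⟩⟩
    · rintro ⟨i, hi⟩
      obtain ⟨u, -, hu⟩ := (h3 i).1 hi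
      exact ⟨u, (mem_squares_iff_evalFamily _ _).2 hu⟩
  obtain ⟨U, hU, hUo, hpU⟩ := mem_nhds_iff.1 hall
  refine ⟨U, hUo, hpU, fun i => {x ∈ U | f i x = 0}, f, fun i => ⟨fun x hx => ?_, fun x hx => ?_,
    rfl⟩, fun i => ⟨hpU, hfp i⟩, hli, ?_⟩
  · exact (((hU hx).1 i).1.of_le (by simp)).contDiffWithinAt
  · exact ((hU hx).1 i).2
  · ext x
    simp only [Set.mem_inter_iff, Set.mem_iUnion, Set.mem_sep_iff]
    constructor
    · rintro ⟨hx, hxU⟩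
      obtain ⟨i, hi⟩ := (hU hxU).2.1 hx
      exact ⟨i, hxU, hi⟩
    · rintro ⟨i, hxU, hi⟩
      exact ⟨(hU hxU).2.2 ⟨i, hi⟩, hxU⟩

/-- Division by the quadratic polynomial `(x - m)² - n`, with quotient and remainder
depending analytically on `(m, n)`. -/
lemma exists_quadratic_division (P : ℝ[X]) : ∃ (c : ℝ × (ℝ × ℝ) → ℝ) (e o : ℝ × ℝ → ℝ),
    ContDiff ℝ ω c ∧ ContDiff ℝ ω e ∧ ContDiff ℝ ω o ∧
    ∀ t w, P.eval t = ((t - w.1) ^ 2 - w.2) * c (t, w) + e w + (t - w.1) * o w := by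
  induction P using Polynomial.induction_on with
  | C a =>
    exact ⟨0, fun _ => a, 0, contDiff_zero_fun, contDiff_const, contDiff_zero_fun, by simp⟩
  | add P R hP hR =>
    obtain ⟨c, e, o, hc, he, ho, h⟩ := hP
    obtain ⟨c', e', o', hc', he', ho', h'⟩ := hR
    refine ⟨fun x => c x + c' x, fun x => e x + e' x, fun x => o x + o' x, hc.add hc', he.add he',
      ho.add ho', fun t w => ?_⟩
    rw [eval_add, h t w, h' t w]; ring
  | monomial n a ih =>
    obtain ⟨c, e, o, hc, he, ho, h⟩ := ih
    refine ⟨fun x => x.1 * c x + o x.2, fun w => w.1 * e w + w.2 * o w,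
      fun w => e w + w.1 * o w, by fun_prop, by fun_prop, by fun_prop, fun t w => ?_⟩
    rw [pow_succ, ← mul_assoc, eval_mul, h t w, eval_X]; ring

/-- `exists_quadratic_division` for the polynomials `Λ Q_a`, analytically in `a` as well. The
quotient is `c`, and the remainder is `r₁ + (x - m) r₂`. -/
lemma exists_quadratic_division_family :
    ∃ (c : (Fin d → ℝ) × (ℝ × (ℝ × ℝ)) → ℝ) (r : (Fin d → ℝ) × (ℝ × ℝ) → ℝ × ℝ),
      ContDiff ℝ ω c ∧ ContDiff ℝ ω r ∧ ∀ a t w, (Λ (Q a)).eval t =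
        ((t - w.1) ^ 2 - w.2) * c (a, (t, w)) + (r (a, w)).1 + (t - w.1) * (r (a, w)).2 := by
  choose c e o hc he ho h using exists_quadratic_division
  refine ⟨fun x => c (Λ (X ^ d)) x.2 + ∑ j : Fin d, x.1 j * c (Λ (X ^ (j : ℕ))) x.2,
    fun x => (e (Λ (X ^ d)) x.2 + ∑ j : Fin d, x.1 j * e (Λ (X ^ (j : ℕ))) x.2,
      o (Λ (X ^ d)) x.2 + ∑ j : Fin d, x.1 j * o (Λ (X ^ (j : ℕ))) x.2), ?_, ?_, fun a t w => ?_⟩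
  · fun_prop
  · fun_prop
  · rw [eval_map_Q, h _ t w]
    simp_rw [fun j : Fin d => h (Λ (X ^ (j : ℕ))) t w, mul_add, Finset.sum_add_distrib,
      Finset.mul_sum]
    have h1 : ∀ j : Fin d, a j * (((t - w.1) ^ 2 - w.2) * c (Λ (X ^ (j : ℕ))) (t, w)) =
        ((t - w.1) ^ 2 - w.2) * (a j * c (Λ (X ^ (j : ℕ))) (t, w)) := fun j => by ring
    have h2 : ∀ j : Fin d, a j * ((t - w.1) * o (Λ (X ^ (j : ℕ))) w) =
        (t - w.1) * (a j * o (Λ (X ^ (j : ℕ))) w) := fun j => by ring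
    simp_rw [h1, h2]; ring

end Family

/-! ### Double pairs and the Whitney umbrella -/

section Umbrella

variable {d : ℕ} (Λ : ℝ[X] →ₗ[ℝ] ℝ[X])

/-- For `n = 0` the remainder is the Taylor polynomial of order one at `m`. -/
lemma remainder_eq_of_division {c : ℝ → ℝ} {P : ℝ[X]} {m : ℝ} {r : ℝ × ℝ} (hc : Differentiable ℝ c)
    (h : ∀ t, P.eval t = ((t - m) ^ 2 - 0) * c t + r.1 + (t - m) * r.2) :
    r = (P.eval m, (derivative P).eval m) := by
  have h1 : P.eval m = r.1 := by simpa using h m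
  have h2 : HasDerivAt (fun t => ((t - m) ^ 2 - 0) * c t + r.1 + (t - m) * r.2) r.2 m := by
    have hd : HasDerivAt (fun t : ℝ => t - m) 1 m := (hasDerivAt_id m).sub_const m
    exact (((((hd.pow 2).sub_const 0).mul (hc m).hasDerivAt).add_const r.1).add
      (hd.mul_const r.2)).congr_deriv (by simp)
  have h3 : (derivative P).eval m = r.2 :=
    (P.hasDerivAt m).unique (by rwa [← funext h] at h2)
  rw [h1, h3]

/-- The quotient of the division by `(x - m)²` at a root of multiplicity exactly two. -/
lemma quotient_eq_of_division {c : ℝ → ℝ} {P : ℝ[X]} {m : ℝ} (hc : Continuous c)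
    (h : ∀ t, P.eval t = (t - m) ^ 2 * c t) (h2 : (X - C m) ^ 2 ∣ P) (h3 : ¬ (X - C m) ^ 3 ∣ P) :
    c m ≠ 0 ∧ (derivative (derivative P)).eval m = 2 * c m := by
  obtain ⟨g, rfl⟩ := h2
  have hcg : ∀ t ≠ m, g.eval t = c t := fun t ht => by
    have := h t
    rw [eval_mul, eval_pow, eval_sub, eval_X, eval_C] at this
    exact mul_left_cancel₀ (pow_ne_zero 2 (sub_ne_zero.2 ht)) this
  have hm : g.eval m = c m := by
    have := Continuous.ext_on (dense_compl_singleton m) g.continuous hc hcg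
    exact congrFun this m
  refine ⟨fun h0 => h3 ?_, ?_⟩
  · rw [h0] at hm
    rw [pow_succ]
    exact mul_dvd_mul_left _ (dvd_iff_isRoot.2 hm)
  · rw [← hm]
    simp [derivative_mul, derivative_pow]

/-- The first-order behaviour of the remainder of the division of `Λ Q_a` by `(x - m)² - n`, at a
double root `t₀` of `Λ Q_p`. -/
lemma exists_division_at_double_root (p : Fin d → ℝ) (t₀ : ℝ) (h2 : (X - C t₀) ^ 2 ∣ Λ (Q p)) :
    ∃ (c : (Fin d → ℝ) × (ℝ × (ℝ × ℝ)) → ℝ) (r : (Fin d → ℝ) × (ℝ × ℝ) → ℝ × ℝ),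
      ContDiff ℝ ω c ∧ ContDiff ℝ ω r ∧
      (∀ a t w, (Λ (Q a)).eval t =
        ((t - w.1) ^ 2 - w.2) * c (a, (t, w)) + (r (a, w)).1 + (t - w.1) * (r (a, w)).2) ∧
      r (p, (t₀, 0)) = 0 ∧
      (∀ h, fderiv ℝ r (p, (t₀, 0)) (h, 0) =
        ((Λ (lowerPart h)).eval t₀, (derivative (Λ (lowerPart h))).eval t₀)) ∧
      (¬ (X - C t₀) ^ 3 ∣ Λ (Q p) → c (p, (t₀, (t₀, 0))) ≠ 0 ∧
        ∀ w, fderiv ℝ r (p, (t₀, 0)) (0, w) = 0 → w = 0) := by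
  obtain ⟨c, r, hc, hr, hdiv⟩ := exists_quadratic_division_family (d := d) Λ
  have hω : (ω : WithTop ℕ∞) ≠ 0 := by simp
  have hcd (a : Fin d → ℝ) (w : ℝ × ℝ) : ContDiff ℝ ω fun t => c (a, (t, w)) := by fun_prop
  have hrem (a : Fin d → ℝ) (m : ℝ) :
      r (a, (m, 0)) = ((Λ (Q a)).eval m, (derivative (Λ (Q a))).eval m) :=
    remainder_eq_of_division ((hcd a (m, 0)).differentiable hω) fun t => hdiv a t (m, 0)
  have hroot : (Λ (Q p)).eval t₀ = 0 ∧ (derivative (Λ (Q p))).eval t₀ = 0 := by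
    obtain ⟨g, hg⟩ := h2
    rw [hg]
    simp [derivative_mul, derivative_pow]
  have hrd : DifferentiableAt ℝ r (p, (t₀, 0)) := (hr.differentiable hω).differentiableAt
  have hr0 : r (p, (t₀, 0)) = 0 := by rw [hrem, hroot.1, hroot.2]; rfl
  refine ⟨c, r, hc, hr, hdiv, hr0, fun h => ?_, fun h3 => ?_⟩
  · refine fderiv_apply_eq_of_hasDerivAt hrd ?_
    have e : (fun s : ℝ => r ((p, (t₀, 0)) + s • (h, 0))) = fun s =>
        (s * (Λ (lowerPart h)).eval t₀, s * (derivative (Λ (lowerPart h))).eval t₀) := by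
      funext s
      have : ((p, ((t₀, 0) : ℝ × ℝ)) + s • (h, (0 : ℝ × ℝ))) = (p + s • h, (t₀, 0)) := by simp
      rw [this, hrem, map_Q_add_smul]
      simp [hroot]
    rw [e]
    exact (hasDerivAt_mul_const _).prodMk (hasDerivAt_mul_const _)
  · have hq := quotient_eq_of_division (P := Λ (Q p)) (hcd p (t₀, 0)).continuous
      (fun t => by simpa [hr0] using hdiv p t (t₀, 0)) h2 h3
    refine ⟨hq.1, ?_⟩
    have hm : fderiv ℝ r (p, (t₀, 0)) (0, (1, 0)) = (0, 2 * c (p, (t₀, (t₀, 0)))) := by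
      refine fderiv_apply_eq_of_hasDerivAt hrd ?_
      have e : (fun s : ℝ => r ((p, (t₀, 0)) + s • (0, (1, 0)))) = fun s =>
          ((Λ (Q p)).eval (t₀ + s), (derivative (Λ (Q p))).eval (t₀ + s)) := by
        funext s
        rw [← hrem]; simp
      rw [e]
      have := (HasDerivAt.comp_const_add t₀ 0 ((Λ (Q p)).hasDerivAt (t₀ + 0))).prodMk
        (HasDerivAt.comp_const_add t₀ 0 ((derivative (Λ (Q p))).hasDerivAt (t₀ + 0)))
      rwa [add_zero, hq.2, hroot.2] at this
    have hn : (fderiv ℝ r (p, (t₀, 0)) (0, (0, 1))).1 = c (p, (t₀, (t₀, 0))) := by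
      have h1 : fderiv ℝ (fun x => (r x).1) (p, (t₀, 0)) (0, (0, 1)) = c (p, (t₀, (t₀, 0))) := by
        refine fderiv_apply_eq_of_hasDerivAt hrd.fst ?_
        -- put `t = m` in the division identity
        have e : (fun s : ℝ => (r ((p, (t₀, 0)) + s • (0, (0, 1)))).1) = fun s =>
            s * c (p, (t₀, (t₀, s))) := by
          funext s
          have := hdiv p t₀ (t₀, s)
          rw [hroot.1] at this
          simp only [Prod.smul_mk, smul_zero, Prod.mk_add_mk, add_zero, zero_add, smul_eq_mul,
            mul_one, mul_zero]
          simp only [sub_self, zero_mul, add_zero] at this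
          linear_combination -this
        rw [e]
        have hcs : ContDiff ℝ ω fun s : ℝ => c (p, (t₀, (t₀, s))) := by fun_prop
        have := (hasDerivAt_id (0 : ℝ)).mul ((hcs.differentiable hω) 0).hasDerivAt
        simp only [id_eq, one_mul, zero_mul, add_zero] at this
        exact this
      rw [← h1]
      exact (DFunLike.congr_fun hrd.hasFDerivAt.fst.fderiv _).symm
    rintro ⟨x, y⟩ hxy
    have e : ((0 : Fin d → ℝ), ((x, y) : ℝ × ℝ)) = x • (0, (1, 0)) + y • (0, (0, 1)) := by simp
    rw [e, map_add, map_smul, map_smul, hm] at hxy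
    have hy : y = 0 := by
      have := congrArg Prod.fst hxy
      simpa [hn, hq.1] using this
    have hx : x = 0 := by
      have := congrArg Prod.snd hxy
      simpa [hy, hq.1] using this
    rw [hx, hy]; rfl

/-- If `t₀` is the only common root of the two parts of `Q_p`, a multiple root of both and exactly
double for one of them, then the polynomials whose parts have a common root form a
Whitney umbrella near `p`. -/
lemma isLocallyDiffeomorphic_whitneyUmbrella {Λ₁ Λ₂ : ℝ[X] →ₗ[ℝ] ℝ[X]}
    (hΛ : ∀ (a : Fin d → ℝ) t, t ∈ squares a ↔ (Λ₁ (Q a)).eval t = 0 ∧ (Λ₂ (Q a)).eval t = 0)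
    (hsurj : ∀ u w : ℝ[X], u.natDegree ≤ 1 → w.natDegree ≤ 1 →
      ∃ h : Fin d → ℝ, Λ₁ (lowerPart h) = u ∧ Λ₂ (lowerPart h) = w)
    {p : Fin d → ℝ} {t₀ : ℝ} (hp : squares p = {t₀}) (h1 : (X - C t₀) ^ 2 ∣ Λ₁ (Q p))
    (h2 : (X - C t₀) ^ 2 ∣ Λ₂ (Q p)) (h3 : ¬ (X - C t₀) ^ 3 ∣ Λ₂ (Q p)) (hd : 4 ≤ d) :
    IsLocallyDiffeomorphic (Etilde d) p
      ((Set.univ : Set (Fin (d - 3) → ℝ)) ×ˢ whitneyUmbrella) (0, 0) := by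
  obtain ⟨c₁, k, -, hk, hdiv₁, hk0, hkd, -⟩ := exists_division_at_double_root Λ₁ p t₀ h1
  obtain ⟨c, f, hc, hf, hdiv₂, hf0, hfd, hex⟩ := exists_division_at_double_root Λ₂ p t₀ h2
  obtain ⟨hc0, hinj⟩ := hex h3
  obtain ⟨g, hg, hgp, hfg, F, hF, hFs, hFp, hFsurj⟩ := exists_submersion hf.contDiffAt
    hk.contDiffAt hf0 hk0 hinj fun y z => by
      have hdeg (x : ℝ × ℝ) : (C x.2 * (X - C t₀) + C x.1).natDegree ≤ 1 := by
        compute_degree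
      obtain ⟨h, e1, e2⟩ := hsurj (C z.2 * (X - C t₀) + C z.1) (C y.2 * (X - C t₀) + C y.1)
        (hdeg z) (hdeg y)
      exact ⟨h, by rw [hfd, e2]; simp, by rw [hkd, e1]; simp⟩
  refine isLocallyDiffeomorphic_preimage hFs hFp hFsurj (by simp; omega) ?_
  have hcont : ContinuousAt (fun x : (Fin d → ℝ) × ℝ => c (x.1, (x.2, g x.1))) (p, t₀) := by
    have hg' : ContinuousAt (fun x : (Fin d → ℝ) × ℝ => g x.1) (p, t₀) :=
      ContinuousAt.comp (f := Prod.fst) hg.continuousAt continuousAt_fst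
    exact hc.continuous.continuousAt.comp (continuousAt_fst.prodMk (continuousAt_snd.prodMk hg'))
  have hne := hcont.eventually_ne (y := 0) (by simpa [hgp] using hc0)
  rw [nhds_prod_eq, eventually_prod_iff] at hne
  obtain ⟨A, hA, N, hN, hAN⟩ := hne
  have hsub := eventually_squares_subset p (isOpen_interior (s := {t | N t})) (by
    rw [hp, Set.singleton_subset_iff]; exact mem_interior_iff_mem_nhds.2 hN)
  filter_upwards [hA, hsub, hfg] with a ha hN' hfa
  have e₁ := fun t => hdiv₁ a t (g a)
  have e₂ := fun t => hdiv₂ a t (g a)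
  simp only [hfa, Prod.fst_zero, Prod.snd_zero, add_zero, mul_zero] at e₂
  rw [mem_Etilde_iff, hF]
  constructor
  · rintro ⟨t, ht⟩
    have htN : N t := interior_subset (hN' ht)
    obtain ⟨z₁, z₂⟩ := (hΛ a t).1 ht
    rw [e₂] at z₂
    have hq : (t - (g a).1) ^ 2 - (g a).2 = 0 :=
      (mul_eq_zero.1 z₂).resolve_right (hAN ha htN)
    rw [e₁, hq] at z₁
    refine ⟨-(k (a, g a)).2, t - (g a).1, ?_⟩
    ext i
    fin_cases i
    · rfl
    · simp; linarith
    · simp; linarith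
  · rintro ⟨u, v, huv⟩
    have h0 : -(k (a, g a)).2 = u := congrFun huv 0
    have h1 : (k (a, g a)).1 = u * v := congrFun huv 1
    have h2 : (g a).2 = v ^ 2 := congrFun huv 2
    refine ⟨(g a).1 + v, (hΛ a _).2 ⟨?_, ?_⟩⟩
    · rw [e₁, h1, h2, ← h0]; ring
    · rw [e₂, h2]; ring

/-- The two cases of the last assertion at once: `z = v` and `z = i v`. -/
lemma isLocallyDiffeomorphic_of_double {p : Fin d → ℝ} {t₀ : ℝ} {z : ℂ} (hz0 : z ≠ 0)
    (hz : z ^ 2 = t₀) (hp : squares p = {t₀}) (h1 : multiplicityAt p z = 2)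
    (h2 : multiplicityAt p (-z) = 2) :
    4 ≤ d ∧ IsLocallyDiffeomorphic (Etilde d) p
      ((Set.univ : Set (Fin (d - 3) → ℝ)) ×ˢ whitneyUmbrella) (0, 0) := by
  have hdvd : (X ^ 2 - C t₀) ^ 2 ∣ Q p := (X_sq_sub_C_pow_dvd_Q_iff p hz0 hz 2).2 (by omega)
  have hndvd : ¬ (X ^ 2 - C t₀) ^ 3 ∣ Q p := fun h => by
    have := (X_sq_sub_C_pow_dvd_Q_iff p hz0 hz 3).1 h
    omega
  have hd : 4 ≤ d := by
    have := natDegree_le_of_dvd hdvd (Q_monic p).ne_zero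
    rwa [natDegree_pow, natDegree_X_pow_sub_C, natDegree_Q] at this
  refine ⟨hd, ?_⟩
  rw [X_sq_sub_C_pow_dvd_iff] at hdvd hndvd
  have hex := fun u w hu hw =>
    exists_evenPart_oddPart_eq (d := d) (u := u) (w := w) (m := 1) hu hw (by omega)
  by_cases ho : (X - C t₀) ^ 3 ∣ oddPart (Q p)
  · refine isLocallyDiffeomorphic_whitneyUmbrella (Λ₁ := oddPart) (Λ₂ := evenPart)
      (fun a t => by rw [mem_squares_iff, and_comm]) (fun u w hu hw => ?_) hp hdvd.2 hdvd.1
      (fun he => hndvd ⟨he, ho⟩) hd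
    obtain ⟨h, e1, e2⟩ := hex w u hw hu
    exact ⟨h, e2, e1⟩
  · exact isLocallyDiffeomorphic_whitneyUmbrella mem_squares_iff hex hp hdvd.1 hdvd.2 ho hd

lemma not_sq_dvd_of_simple {p : Fin d → ℝ} (h : ∀ z, multiplicityAt p z ≤ 1) {t : ℝ}
    (ht : t ∈ squares p) : ¬ (X ^ 2 - C t) ^ 2 ∣ Q p := by
  intro hdvd
  obtain ⟨z, hz⟩ := IsAlgClosed.exists_pow_nat_eq (t : ℂ) two_pos
  rcases eq_or_ne z 0 with rfl | hz0
  · have h0 : t = 0 := by simpa using hz.symm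
    rw [h0, zero_mem_squares_iff] at ht
    have := h 0
    omega
  · have := ((X_sq_sub_C_pow_dvd_Q_iff p hz0 hz 2).1 hdvd).1
    have := h z
    omega

lemma isLocallyTransversalCrossing_Etilde {p : Fin d → ℝ} (h : (complexRoots p).ncard = d) :
    IsLocallyTransversalCrossing (Etilde d) p
      ((oppositeModuli p).ncard + (imaginaryModuli p).ncard) :=
  isLocallyTransversalCrossing_of_simple (.of_forall mem_Etilde_iff)
    (fun _ => not_sq_dvd_of_simple (multiplicityAt_le_one h))
    (ncard_squares p (multiplicityAt_le_one h 0))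

lemma isLocallyTransversalCrossing_E {p : Fin d → ℝ} (h : (realRoots p).ncard = d) :
    IsLocallyTransversalCrossing (E d) p (oppositeModuli p).ncard := by
  have hm := multiplicityAt_le_one (ncard_complexRoots h)
  have hcard := ncard_squares p (hm 0)
  rw [imaginaryModuli_eq_empty h, Set.ncard_empty, add_zero] at hcard
  refine isLocallyTransversalCrossing_of_simple ?_ (fun _ => not_sq_dvd_of_simple hm) hcard
  have hpos : squares p ⊆ Set.Ioi 0 := by
    rw [squares_eq p (hm 0), imaginaryModuli_eq_empty h, Set.image_empty, Set.union_empty]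
    rintro _ ⟨v, hv, rfl⟩
    exact pow_pos hv.1 2
  filter_upwards [eventually_squares_subset p isOpen_Ioi hpos] with a ha
  rw [mem_E_iff]
  exact ⟨fun ⟨t, ht, _⟩ => ⟨t, ht⟩, fun ⟨t, ht⟩ => ⟨t, ht, ha ht⟩⟩

/-- A crossing of a single hypersurface is a smooth hypersurface. -/
lemma IsLocallyTransversalCrossing.isLocallySmoothHypersurface {V : Type*} [NormedAddCommGroup V]
    [NormedSpace ℝ V] {S : Set V} {p : V} (h : IsLocallyTransversalCrossing S p 1) :
    IsLocallySmoothHypersurface S p := by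
  obtain ⟨U, hU, hpU, H, f, hH, hpH, -, hSU⟩ := h
  have e : S ∩ U = H 0 := by rw [hSU]; ext x; simp [Fin.exists_fin_one]
  exact ⟨U, hU, hpU, Set.inter_subset_left (e ▸ hpH 0), f 0, e ▸ hH 0⟩

end Umbrella

end RootModuli

end

theorem theorem1 (d : ℕ) (p : Fin d → ℝ) :
    -- (1) `d` distinct real roots, exactly one equality
    ((RootModuli.realRoots p).ncard = d → (RootModuli.oppositeModuli p).ncard = 1 →
      RootModuli.IsLocallySmoothHypersurface (RootModuli.E d) p) ∧
    -- (2) `d` distinct real roots, exactly `s` equalities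
    (∀ s : ℕ, (RootModuli.realRoots p).ncard = d → (RootModuli.oppositeModuli p).ncard = s →
      RootModuli.IsLocallyTransversalCrossing (RootModuli.E d) p s) ∧
    -- (3) `d` distinct complex roots, exactly `s₁` equalities and `s₂` purely imaginary pairs
    (∀ s₁ s₂ : ℕ, (RootModuli.complexRoots p).ncard = d →
      (RootModuli.oppositeModuli p).ncard = s₁ → (RootModuli.imaginaryModuli p).ncard = s₂ →
      RootModuli.IsLocallyTransversalCrossing (RootModuli.Etilde d) p (s₁ + s₂)) ∧
    -- (4) two double opposite real roots, or a double purely imaginary pair, and nothing else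
    -- that contributes to `Etilde d`
    ((∃ v : ℝ,
        ((RootModuli.oppositeModuli p = {v} ∧ RootModuli.imaginaryModuli p = ∅ ∧
          RootModuli.multiplicityAt p (v : ℂ) = 2 ∧
          RootModuli.multiplicityAt p (-(v : ℂ)) = 2) ∨
         (RootModuli.imaginaryModuli p = {v} ∧ RootModuli.oppositeModuli p = ∅ ∧
          RootModuli.multiplicityAt p ((v : ℂ) * Complex.I) = 2 ∧
          RootModuli.multiplicityAt p (-((v : ℂ) * Complex.I)) = 2)) ∧
        RootModuli.multiplicityAt p 0 ≤ 1) →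
      4 ≤ d ∧ RootModuli.IsLocallyDiffeomorphic (RootModuli.Etilde d) p
        ((Set.univ : Set (Fin (d - 3) → ℝ)) ×ˢ RootModuli.whitneyUmbrella) (0, 0)) := by
  refine ⟨fun h h1 => ?_, fun s h hs => ?_, fun s₁ s₂ h h₁ h₂ => ?_, ?_⟩
  · exact (h1 ▸ RootModuli.isLocallyTransversalCrossing_E h).isLocallySmoothHypersurface
  · exact hs ▸ RootModuli.isLocallyTransversalCrossing_E h
  · exact h₁ ▸ h₂ ▸ RootModuli.isLocallyTransversalCrossing_Etilde h
  · rintro ⟨v, ⟨ho, hi, m₁, m₂⟩ | ⟨hi, ho, m₁, m₂⟩, h0⟩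
    · have hv : 0 < v := (ho.symm ▸ Set.mem_singleton v : v ∈ RootModuli.oppositeModuli p).1
      exact RootModuli.isLocallyDiffeomorphic_of_double (t₀ := v ^ 2)
        (by exact_mod_cast hv.ne') (by simp) (by simp [RootModuli.squares_eq p h0, ho, hi]) m₁ m₂
    · have hv : 0 < v := (hi.symm ▸ Set.mem_singleton v : v ∈ RootModuli.imaginaryModuli p).1
      exact RootModuli.isLocallyDiffeomorphic_of_double (t₀ := -v ^ 2)
        (mul_ne_zero (by exact_mod_cast hv.ne') Complex.I_ne_zero) (by simp [mul_pow])
        (by simp [RootModuli.squares_eq p h0, ho, hi]) m₁ m₂
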